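/- Let $D \ge 1$, $n \ge 2$, $c_1, c_2 \in \mathbb{R}^D$ and $\sigma_1, \sigma_2 > 0$. For $j = 1, 2$ suppose that the optima of the models near $c_j$ are distributed as $N(c_j, \sigma_j^2 I)$ on $\mathbb{R}^D$, and let $E_j = \mathbb{E}_{p \sim N(c_j, \sigma_j^2 I)}\|c_j - p\|^2$ be the expected squared distance from $c_j$ to the optimum of a model. Let $p_{j,1}, \dots, p_{j,n}$ be the optima of $n$ training models: random vectors with law $N(c_j, \sigma_j^2 I)$, where all $2n$ vectors $p_{j,i}$ are independent. Let the optimum of the $j$-th ensemble be the sample mean $c_t^j = \frac1n \sum_i p_{j,i}$, with sample spread $s_j^2 = \frac1n \sum_i \|p_{j,i} - c_t^j\|^2$. Let $F(m, k)$ be the F-distribution and $F_\alpha(m, k)$ its upper $\alpha$-quantile. Then: 1. $E_1$ and $E_2$ are finite, and $E_1 \ge E_2$ if and only if $\sigma_1 \ge \sigma_2$. 2. $n s_j^2 / \sigma_j^2 \sim \chi^2(D(n-1))$ for $j = 1, 2$, and $\frac{s_1^2 \sigma_2^2}{s_2^2 \sigma_1^2} \sim F(D(n-1), D(n-1))$.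 3. The test that concludes $E_1 \ge E_2$ (that is, $\sigma_1 \ge \sigma_2$) when $s_1^2 / s_2^2 \ge F_\alpha(n-1, n-1)$ has type-I error at most $\alpha$, for every $0 < \alpha \le \frac12$: if $E_1 \le E_2$, then $\mathbb{P}\left(s_1^2/s_2^2 \ge F_\alpha(n-1, n-1)\right) \le \alpha$. 4. For every $0 < \alpha < 1$, the same test with the threshold $F_\alpha(D(n-1), D(n-1))$, which is $F_\alpha(n-1, n-1)$ when $D = 1$, has type-I error exactly $\alpha$: if $E_1 \le E_2$, then $\mathbb{P}\left(s_1^2/s_2^2 \ge F_\alpha(D(n-1), D(n-1))\right) \le \alpha$, with equality if $E_1 = E_2$. -/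

import Mathlib

open MeasureTheory ProbabilityTheory

namespace EnsembleOptima

noncomputable section

/-- The isotropic Gaussian distribution `N(c, σ² I)` on `ℝ^D`: the law of the optimum of a model
drawn from the model population. -/
def optimumLaw {D : ℕ} (c : EuclideanSpace ℝ (Fin D)) (σ : ℝ) :
    Measure (EuclideanSpace ℝ (Fin D)) :=
  multivariateGaussian c (σ ^ 2 • (1 : Matrix (Fin D) (Fin D) ℝ))

/-- The expected squared distance `𝔼[‖c - p‖²]` from `c` to the optimum `p ∼ N(c, σ² I)` of a
model of the population. -/
def expectedSqDist {D : ℕ} (c : EuclideanSpace ℝ (Fin D)) (σ : ℝ) : ℝ :=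
  ∫ p, ‖c - p‖ ^ 2 ∂(optimumLaw c σ)

/-- The optimum of the ensemble, `c_t = (1/n) ∑ p_i`. -/
def ensembleOptimum {D n : ℕ} (p : Fin n → EuclideanSpace ℝ (Fin D)) :
    EuclideanSpace ℝ (Fin D) :=
  (1 / (n : ℝ)) • ∑ i, p i

/-- The sample spread `s² = (1/n) ∑ ‖p_i - c_t‖²`. -/
def sampleSpread {D n : ℕ} (p : Fin n → EuclideanSpace ℝ (Fin D)) : ℝ :=
  (1 / (n : ℝ)) * ∑ i, ‖p i - ensembleOptimum p‖ ^ 2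

/-- The chi-square distribution with `k ≥ 1` degrees of freedom. -/
def chiSquare (k : ℕ) : Measure ℝ :=
  gammaMeasure ((k : ℝ) / 2) (1 / 2)

/-- The F-distribution with parameters `m, n ≥ 1`: the law of `(X / m) / (Y / n)` for independent
`X ∼ χ²(m)` and `Y ∼ χ²(n)`. -/
def fDistribution (m n : ℕ) : Measure ℝ :=
  ((chiSquare m).prod (chiSquare n)).map fun z => (z.1 / (m : ℝ)) / (z.2 / (n : ℝ))

/-- The upper `α`-quantile of a probability measure on `ℝ`: the least `x` that is exceeded with
probability at most `α` (for `0 < α < 1`). -/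
def upperQuantile (μ : Measure ℝ) (α : ℝ) : ℝ :=
  sInf {x : ℝ | μ.real (Set.Ioi x) ≤ α}

end

end EnsembleOptima

namespace EnsembleOptima

open scoped ENNReal

/-! Stack a standardised sample into one Gaussian vector of `(ℝ^D)^n`. Then `n s²` is the squared
norm of its projection onto the orthogonal complement of the diagonal, a space of dimension
`D(n-1)`. This gives the chi-square laws (`hasLaw_sampleSpread`), and by independence the F-law of
the ratio.

Under the null hypothesis `σ₁ ≤ σ₂`, the ratio `s₁²/s₂²` is at most the F-distributed one, so part 4
reduces to the exact tail of an atomless law at its quantile (`measureReal_Ici_upperQuantile`).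

Part 3 also compares `F(k, k)` for different `k`. All have median `1`, by symmetry under inversion,
and density proportional to `w⁻¹ (w/(1+w)²)^(k/2)`. The ratio of two such densities is monotone on
`[1, ∞)`, so tails beyond `1` shrink as `k` grows (`fDistribution_self_Ici_antitone`). The condition
`α ≤ 1/2` puts the quantile in that range. -/

/-! ### Chi-square as the law of a squared Gaussian norm. -/

lemma isProbabilityMeasure_chiSquare {k : ℕ} (hk : 1 ≤ k) :
    IsProbabilityMeasure (chiSquare k) :=
  isProbabilityMeasure_gammaMeasure (by positivity) (by norm_num)

lemma chiSquare_eq_withDensity_restrict (k : ℕ) :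
    chiSquare k =
      (volume.restrict (Set.Ioi 0)).withDensity (gammaPDF ((k : ℝ) / 2) (1 / 2)) := by
  rw [chiSquare, gammaMeasure, ← restrict_withDensity measurableSet_Ioi, eq_comm]
  refine Measure.restrict_eq_self_of_ae_mem ?_
  change (volume.withDensity (gammaPDF ((k : ℝ) / 2) (1 / 2))) (Set.Ioi 0)ᶜ = 0
  rw [withDensity_apply _ measurableSet_Ioi.compl, Set.compl_Ioi,
    setLIntegral_congr Iio_ae_eq_Iic.symm]
  exact lintegral_gammaPDF_of_nonpos le_rfl

lemma integral_chiSquare {E : Type*} [NormedAddCommGroup E] [NormedSpace ℝ E] {k : ℕ}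
    (hk : 1 ≤ k) (f : ℝ → E) :
    ∫ x, f x ∂(chiSquare k) = ((1 / 2 : ℝ) ^ ((k : ℝ) / 2) / Real.Gamma (k / 2)) •
      ∫ x in Set.Ioi (0 : ℝ), (x ^ ((k : ℝ) / 2 - 1) * Real.exp (-(1 / 2 * x))) • f x := by
  rw [chiSquare_eq_withDensity_restrict, integral_withDensity_eq_integral_toReal_smul
    (by unfold gammaPDF; fun_prop) (by simp [gammaPDF]), ← integral_smul]
  refine setIntegral_congr_fun measurableSet_Ioi fun x hx ↦ ?_
  have hx : 0 < x := hx
  have hk' : (0 : ℝ) < k / 2 := by positivity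
  have := gammaPDFReal_nonneg hk' (by norm_num : (0 : ℝ) < 1 / 2) x
  simp only [gammaPDF]
  rw [ENNReal.toReal_ofReal this, gammaPDFReal, if_pos hx.le, smul_smul]
  congr 1
  ring

/-- Polar coordinates, then `u = r²`. The volume of the ball stays unevaluated, since normalisation
later removes it. -/
lemma integral_norm_sq_euclideanSpace {F : Type*} [NormedAddCommGroup F] [NormedSpace ℝ F]
    {d : ℕ} (hd : 1 ≤ d) (G : ℝ → F) :
    ∫ x : EuclideanSpace ℝ (Fin d), G (‖x‖ ^ 2) =
      (d * (volume : Measure (EuclideanSpace ℝ (Fin d))).real (Metric.ball 0 1) / 2) •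
        ∫ u in Set.Ioi (0 : ℝ), u ^ ((d : ℝ) / 2 - 1) • G u := by
  have : Nonempty (Fin d) := ⟨⟨0, hd⟩⟩
  have h := integral_fun_norm_addHaar (volume : Measure (EuclideanSpace ℝ (Fin d)))
    (fun r ↦ G (r ^ 2))
  have hsub : ∫ u in Set.Ioi (0 : ℝ), u ^ ((d : ℝ) / 2 - 1) • G u =
      (2 : ℝ) • ∫ y in Set.Ioi (0 : ℝ), y ^ (d - 1) • G (y ^ 2) := by
    rw [← integral_comp_rpow_Ioi_of_pos (p := 2) (by norm_num), ← integral_smul]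
    refine setIntegral_congr_fun measurableSet_Ioi fun y hy ↦ ?_
    have hy : 0 < y := hy
    simp only [smul_smul, Real.rpow_ofNat]
    congr 1
    rw [← Real.rpow_natCast y 2, ← Real.rpow_mul hy.le, mul_assoc, ← Real.rpow_add hy,
      ← Real.rpow_natCast y (d - 1), Nat.cast_sub hd]
    congr 2
    push_cast
    ring
  rw [h, hsub, finrank_euclideanSpace_fin, ← Nat.cast_smul_eq_nsmul ℝ, smul_smul, smul_smul]
  congr 1
  ring

/-- Since `G` turns sums into products, both integrals factor over the coordinates. The intended `G`
is `x ↦ exp(itx)`. -/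
lemma integral_norm_sq_stdGaussian {d : ℕ} (G : ℝ → ℂ) (hG : ∀ x y, G (x + y) = G x * G y)
    (h0 : G 0 = 1) :
    ∫ x, G (‖x‖ ^ 2) ∂(stdGaussian (EuclideanSpace ℝ (Fin d))) =
      ((Real.sqrt (2 * Real.pi))⁻¹ ^ d : ℝ) •
        ∫ x : EuclideanSpace ℝ (Fin d), Real.exp (-(1 / 2 * ‖x‖ ^ 2)) • G (‖x‖ ^ 2) := by
  have hsum : ∀ y : Fin d → ℝ, G (∑ i, y i) = ∏ i, G (y i) := fun y ↦ by
    let g : Multiplicative ℝ →* ℂ :=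
      { toFun := fun x ↦ G x.toAdd, map_one' := h0, map_mul' := fun x y ↦ hG _ _ }
    exact map_prod g (fun i ↦ Multiplicative.ofAdd (y i)) Finset.univ
  have hone : ∫ x, G (x ^ 2) ∂(gaussianReal 0 1) =
      ((Real.sqrt (2 * Real.pi))⁻¹ : ℝ) *
        ∫ x : ℝ, ((Real.exp (-(1 / 2 * x ^ 2)) : ℝ) : ℂ) * G (x ^ 2) := by
    rw [integral_gaussianReal_eq_integral_smul one_ne_zero, ← integral_const_mul]
    refine integral_congr_ae (.of_forall fun x ↦ ?_)
    simp only [gaussianPDFReal, Complex.real_smul, NNReal.coe_one, mul_one, sub_zero,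
      Complex.ofReal_mul, mul_assoc]
    congr 4
    ring
  rw [← map_pi_eq_stdGaussian, ← (PiLp.volume_preserving_toLp (Fin d)).map_eq,
    show (WithLp.toLp 2 : (Fin d → ℝ) → _) = MeasurableEquiv.toLp 2 (Fin d → ℝ) from rfl,
    integral_map_equiv, integral_map_equiv]
  simp only [MeasurableEquiv.toLp_apply, EuclideanSpace.real_norm_sq_eq, hsum]
  rw [integral_fintype_prod_eq_prod (f := fun _ x ↦ G (x ^ 2))]
  simp_rw [Finset.mul_sum, ← Finset.sum_neg_distrib, Real.exp_sum, Complex.real_smul,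
    Complex.ofReal_prod, ← Finset.prod_mul_distrib, volume_pi]
  rw [integral_fintype_prod_eq_prod
    (f := fun _ (x : ℝ) ↦ ((Real.exp (-(1 / 2 * x ^ 2)) : ℝ) : ℂ) * G (x ^ 2))]
  simp only [hone, Finset.prod_const, Finset.card_univ, Fintype.card_fin, mul_pow,
    Complex.ofReal_pow]

/-- The squared norm of a standard Gaussian vector in dimension `k` has the chi-square distribution
with `k` degrees of freedom. -/
lemma map_norm_sq_stdGaussian_euclideanSpace {k : ℕ} (hk : 1 ≤ k) :
    (stdGaussian (EuclideanSpace ℝ (Fin k))).map (fun x ↦ ‖x‖ ^ 2) = chiSquare k := by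
  have := isProbabilityMeasure_chiSquare hk
  have := Measure.isProbabilityMeasure_map (μ := stdGaussian (EuclideanSpace ℝ (Fin k)))
    (f := fun x ↦ ‖x‖ ^ 2) (by fun_prop)
  -- Proportionality suffices: both measures are probabilities, so `t = 0` forces `c = 1`.
  have key : ∃ c : ℝ, ∀ t : ℝ,
      charFun ((stdGaussian (EuclideanSpace ℝ (Fin k))).map (fun x ↦ ‖x‖ ^ 2)) t =
        c * charFun (chiSquare k) t := by
    have hΓ : 0 < Real.Gamma (k / 2) := Real.Gamma_pos_of_pos (by positivity)
    set A := (1 / 2 : ℝ) ^ ((k : ℝ) / 2) / Real.Gamma (k / 2) with hA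
    have hA0 : A ≠ 0 := by positivity
    refine ⟨(√(2 * Real.pi))⁻¹ ^ k *
      (k * (volume : Measure (EuclideanSpace ℝ (Fin k))).real (Metric.ball 0 1) / 2) * A⁻¹,
      fun t ↦ ?_⟩
    rw [charFun_apply_real, charFun_apply_real, integral_map (by fun_prop) (by fun_prop),
      integral_norm_sq_stdGaussian (fun x ↦ Complex.exp (t * x * Complex.I)),
      integral_norm_sq_euclideanSpace hk
        (fun x ↦ Real.exp (-(1 / 2 * x)) • Complex.exp (t * x * Complex.I)),
      integral_chiSquare hk]
    · simp_rw [smul_smul]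
      rw [← hA, ← Complex.real_smul, smul_smul, mul_assoc _ A⁻¹ A, inv_mul_cancel₀ hA0, mul_one]
    · intro x y
      rw [← Complex.exp_add]
      congr 1
      push_cast
      ring
    · simp
  obtain ⟨c, hc⟩ := key
  have h1 : (c : ℂ) = 1 := by simpa using (hc 0).symm
  refine Measure.ext_of_charFun (funext fun t ↦ ?_)
  rw [hc, h1, one_mul]

lemma map_norm_sq_stdGaussian {E : Type*} [NormedAddCommGroup E] [InnerProductSpace ℝ E]
    [FiniteDimensional ℝ E] [MeasurableSpace E] [BorelSpace E] {k : ℕ}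
    (hE : Module.finrank ℝ E = k) (hk : 1 ≤ k) :
    (stdGaussian E).map (fun x ↦ ‖x‖ ^ 2) = chiSquare k := by
  subst hE
  rw [← map_norm_sq_stdGaussian_euclideanSpace hk,
    ← stdGaussian_map (stdOrthonormalBasis ℝ E).repr, Measure.map_map (by fun_prop) (by fun_prop)]
  congr 1
  ext x
  simp

/-! ### Gaussian projections and the law of the sample spread. -/

lemma map_orthogonalProjection_stdGaussian {E : Type*} [NormedAddCommGroup E]
    [InnerProductSpace ℝ E] [FiniteDimensional ℝ E] [MeasurableSpace E] [BorelSpace E]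
    (K : Submodule ℝ E) :
    (stdGaussian E).map K.orthogonalProjectionOnto = stdGaussian K := by
  refine Measure.ext_of_charFun (funext fun t ↦ ?_)
  rw [charFun_stdGaussian, charFun_apply, integral_map (by fun_prop) (by fun_prop)]
  have h := charFun_stdGaussian (t : E)
  rw [charFun_apply] at h
  simpa only [Submodule.inner_orthogonalProjectionOnto_eq_of_mem_right, Submodule.coe_norm] using h

lemma map_pi_stdGaussian_toLp {ι E : Type*} [Fintype ι] [NormedAddCommGroup E]
    [InnerProductSpace ℝ E] [FiniteDimensional ℝ E] [MeasurableSpace E] [BorelSpace E] :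
    (Measure.pi fun _ : ι ↦ stdGaussian E).map (WithLp.toLp 2) =
      stdGaussian (PiLp 2 fun _ : ι ↦ E) := by
  refine Measure.ext_of_charFun (funext fun t ↦ ?_)
  rw [charFun_pi, charFun_stdGaussian]
  simp only [charFun_stdGaussian, ← Complex.exp_sum, ← Complex.ofReal_pow]
  rw [PiLp.norm_sq_eq_of_L2]
  congr 1
  push_cast
  rw [← Finset.sum_div, Finset.sum_neg_distrib]

/-- The diagonal of `E ^ n`. -/
def diagonal (ι E : Type*) [Fintype ι] [NormedAddCommGroup E] [InnerProductSpace ℝ E] :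
    Submodule ℝ (PiLp 2 fun _ : ι ↦ E) :=
  LinearMap.range ((WithLp.linearEquiv 2 ℝ (ι → E)).symm.toLinearMap ∘ₗ
    LinearMap.pi fun _ ↦ LinearMap.id)

lemma mem_diagonal {ι E : Type*} [Fintype ι] [NormedAddCommGroup E] [InnerProductSpace ℝ E]
    {x : PiLp 2 fun _ : ι ↦ E} : x ∈ diagonal ι E ↔ ∃ v : E, x = WithLp.toLp 2 fun _ ↦ v := by
  simp only [diagonal, LinearMap.mem_range]
  exact exists_congr fun v ↦ eq_comm

lemma finrank_diagonal {ι E : Type*} [Fintype ι] [Nonempty ι] [NormedAddCommGroup E]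
    [InnerProductSpace ℝ E] : Module.finrank ℝ (diagonal ι E) = Module.finrank ℝ E := by
  refine LinearMap.finrank_range_of_inj fun v w h ↦ ?_
  obtain ⟨i⟩ := ‹Nonempty ι›
  exact congrArg (fun x : PiLp 2 fun _ : ι ↦ E ↦ x i) h

lemma finrank_diagonal_orthogonal {D n : ℕ} (hn : 1 ≤ n) :
    Module.finrank ℝ (diagonal (Fin n) (EuclideanSpace ℝ (Fin D)))ᗮ = D * (n - 1) := by
  have : Nonempty (Fin n) := ⟨⟨0, hn⟩⟩
  have h := Submodule.finrank_add_finrank_orthogonal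
    (diagonal (Fin n) (EuclideanSpace ℝ (Fin D)))
  have h2 : Module.finrank ℝ (PiLp 2 fun _ : Fin n ↦ EuclideanSpace ℝ (Fin D)) = n * D := by
    rw [(WithLp.linearEquiv 2 ℝ (Fin n → EuclideanSpace ℝ (Fin D))).finrank_eq,
      Module.finrank_pi_fintype]
    simp
  rw [finrank_diagonal, finrank_euclideanSpace_fin, h2] at h
  obtain ⟨m, rfl⟩ := Nat.exists_eq_add_of_le hn
  rw [Nat.add_sub_cancel_left]
  linarith

/-- Projecting onto the diagonal replaces every entry by the mean; the residual consists of the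
deviations from it. -/
lemma norm_sq_orthogonalProjection_diagonal {D n : ℕ} (hn : 1 ≤ n)
    (x : Fin n → EuclideanSpace ℝ (Fin D)) :
    ‖(diagonal (Fin n) (EuclideanSpace ℝ (Fin D)))ᗮ.orthogonalProjectionOnto
      (WithLp.toLp 2 x)‖ ^ 2 = n * sampleSpread x := by
  have hn0 : (n : ℝ) ≠ 0 := by positivity
  have hproj : (diagonal (Fin n) (EuclideanSpace ℝ (Fin D)))ᗮ.starProjection (WithLp.toLp 2 x) =
      WithLp.toLp 2 fun i ↦ x i - ensembleOptimum x := by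
    refine Submodule.eq_starProjection_of_mem_orthogonal ?_ ?_
    · rw [Submodule.mem_orthogonal]
      intro u hu
      obtain ⟨v, rfl⟩ := mem_diagonal.1 hu
      rw [PiLp.inner_apply]
      simp only
      rw [← inner_sum, Finset.sum_sub_distrib, ensembleOptimum]
      simp [← Nat.cast_smul_eq_nsmul ℝ, smul_smul, hn0]
    · rw [Submodule.orthogonal_orthogonal]
      refine mem_diagonal.2 ⟨ensembleOptimum x, ?_⟩
      ext i
      simp
  have : ‖(diagonal (Fin n) (EuclideanSpace ℝ (Fin D)))ᗮ.orthogonalProjectionOnto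
      (WithLp.toLp 2 x)‖ = ‖(diagonal (Fin n) (EuclideanSpace ℝ (Fin D)))ᗮ.starProjection
        (WithLp.toLp 2 x)‖ := rfl
  rw [this, hproj, PiLp.norm_sq_eq_of_L2, sampleSpread, ← mul_assoc, mul_one_div_cancel hn0,
    one_mul]

@[fun_prop]
lemma measurable_sampleSpread {D n : ℕ} :
    Measurable (sampleSpread : (Fin n → EuclideanSpace ℝ (Fin D)) → ℝ) := by
  unfold sampleSpread ensembleOptimum
  fun_prop

lemma map_sampleSpread_pi_stdGaussian {D n : ℕ} (hD : 1 ≤ D) (hn : 2 ≤ n) :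
    (Measure.pi fun _ : Fin n ↦ stdGaussian (EuclideanSpace ℝ (Fin D))).map
      (fun x ↦ n * sampleSpread x) = chiSquare (D * (n - 1)) := by
  rw [← map_norm_sq_stdGaussian (finrank_diagonal_orthogonal (D := D) (n := n) (by omega))
    (Nat.mul_pos hD (by omega)), ← map_orthogonalProjection_stdGaussian,
    Measure.map_map (by fun_prop) (by fun_prop),
    ← map_pi_stdGaussian_toLp (ι := Fin n) (E := EuclideanSpace ℝ (Fin D)),
    Measure.map_map (by fun_prop) (by fun_prop)]
  congr 1
  ext x
  exact (norm_sq_orthogonalProjection_diagonal (by omega) x).symm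

open scoped MatrixOrder in
lemma optimumLaw_eq_map_stdGaussian {D : ℕ} (c : EuclideanSpace ℝ (Fin D)) {σ : ℝ} (hσ : 0 < σ) :
    optimumLaw c σ = (stdGaussian (EuclideanSpace ℝ (Fin D))).map fun x ↦ c + σ • x := by
  have hsqrt : CFC.sqrt (σ ^ 2 • (1 : Matrix (Fin D) (Fin D) ℝ)) = σ • 1 := by
    refine CFC.sqrt_unique ?_ (Matrix.PosSemidef.one.smul hσ.le).nonneg
    rw [smul_mul_smul_comm, mul_one, sq]
  rw [optimumLaw, multivariateGaussian, hsqrt]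
  simp

lemma sampleSpread_add_smul {D n : ℕ} (hn : 1 ≤ n) (c : EuclideanSpace ℝ (Fin D)) (σ : ℝ)
    (x : Fin n → EuclideanSpace ℝ (Fin D)) :
    sampleSpread (fun i ↦ c + σ • x i) = σ ^ 2 * sampleSpread x := by
  have hn0 : (n : ℝ) ≠ 0 := by positivity
  have h : ensembleOptimum (fun i ↦ c + σ • x i) = c + σ • ensembleOptimum x := by
    simp only [ensembleOptimum, Finset.sum_add_distrib, ← Finset.smul_sum, smul_add, Finset.sum_const,
      Finset.card_univ, Fintype.card_fin, ← Nat.cast_smul_eq_nsmul ℝ, smul_smul]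
    rw [one_div_mul_cancel hn0, one_smul, mul_comm]
  simp only [sampleSpread, h, add_sub_add_left_eq_sub, ← smul_sub, norm_smul, mul_pow,
    ← Finset.mul_sum, Real.norm_eq_abs, sq_abs]
  ring

lemma hasLaw_sampleSpread {Ω : Type*} [MeasurableSpace Ω] {P : Measure Ω} {D n : ℕ} (hD : 1 ≤ D)
    (hn : 2 ≤ n) {c : EuclideanSpace ℝ (Fin D)} {σ : ℝ} (hσ : 0 < σ)
    {p : Fin n → Ω → EuclideanSpace ℝ (Fin D)} (hp : ∀ i, HasLaw (p i) (optimumLaw c σ) P)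
    (hindep : iIndepFun p P) :
    HasLaw (fun ω ↦ n * sampleSpread (fun i ↦ p i ω) / σ ^ 2) (chiSquare (D * (n - 1))) P := by
  refine HasLaw.fun_comp (Y := fun x ↦ n * sampleSpread x / σ ^ 2) ⟨by fun_prop, ?_⟩
    (hindep.hasLaw_pi hp)
  rw [optimumLaw_eq_map_stdGaussian c hσ]
  rw [← Measure.pi_map_pi (fun _ ↦ by fun_prop), Measure.map_map (by fun_prop) (by fun_prop),
    ← map_sampleSpread_pi_stdGaussian hD hn]
  congr 1
  ext x
  simp only [Function.comp_apply, sampleSpread_add_smul (by omega : 1 ≤ n)]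
  field_simp

/-! ### The expected squared distance. -/

lemma integrable_norm_sq_optimumLaw {D : ℕ} (c : EuclideanSpace ℝ (Fin D)) (σ : ℝ) :
    Integrable (fun p ↦ ‖c - p‖ ^ 2) (optimumLaw c σ) := by
  have h : IsGaussian (optimumLaw c σ) := isGaussian_multivariateGaussian
  exact ((memLp_const c).sub IsGaussian.memLp_two_id).integrable_norm_pow (by norm_num)

/-- Comparing deviations needs only `K > 0`, which follows because a single coordinate already
contributes variance `1`. -/
lemma exists_expectedSqDist_eq {D : ℕ} (hD : 1 ≤ D) :
    ∃ K : ℝ, 0 < K ∧ ∀ (c : EuclideanSpace ℝ (Fin D)) (σ : ℝ), 0 < σ →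
      expectedSqDist c σ = K * σ ^ 2 := by
  refine ⟨∫ x, ‖x‖ ^ 2 ∂(stdGaussian (EuclideanSpace ℝ (Fin D))), ?_, fun c σ hσ ↦ ?_⟩
  · have hint : Integrable (fun x ↦ ‖x‖ ^ 2) (stdGaussian (EuclideanSpace ℝ (Fin D))) :=
      IsGaussian.memLp_two_id.integrable_norm_pow (by norm_num)
    let i : Fin D := ⟨0, hD⟩
    have hvar := variance_eval_multivariateGaussian (μ := 0) Matrix.PosSemidef.one i
    rw [multivariateGaussian_zero_one, Matrix.one_apply_eq] at hvar
    calc (0 : ℝ) < 1 := one_pos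
      _ ≤ ∫ x, ‖x‖ ^ 2 ∂(stdGaussian (EuclideanSpace ℝ (Fin D))) := by
        rw [← hvar]
        refine (variance_le_expectation_sq (by fun_prop)).trans ?_
        refine integral_mono_of_nonneg (.of_forall fun x ↦ sq_nonneg _) hint
          (.of_forall fun x ↦ ?_)
        simp only [Pi.pow_apply]
        rw [← sq_abs, ← Real.norm_eq_abs]
        gcongr
        exact PiLp.norm_apply_le x i
  · rw [expectedSqDist, optimumLaw_eq_map_stdGaussian c hσ,
      integral_map (by fun_prop) (by fun_prop)]
    simp only [sub_add_cancel_left, norm_neg, norm_smul, mul_pow, integral_const_mul,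
      Real.norm_eq_abs, sq_abs]
    ring

/-! ### The law `F(k, k)`: inversion symmetry, density and median. -/

lemma isProbabilityMeasure_fDistribution {m n : ℕ} (hm : 1 ≤ m) (hn : 1 ≤ n) :
    IsProbabilityMeasure (fDistribution m n) := by
  have := isProbabilityMeasure_chiSquare hm
  have := isProbabilityMeasure_chiSquare hn
  exact Measure.isProbabilityMeasure_map (by fun_prop)

lemma fDistribution_self {k : ℕ} (hk : 1 ≤ k) :
    fDistribution k k = ((chiSquare k).prod (chiSquare k)).map fun z ↦ z.1 / z.2 := by
  rw [fDistribution]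
  congr 1
  ext z
  exact div_div_div_cancel_right₀ (by positivity) _ _

lemma map_inv_fDistribution_self {k : ℕ} (hk : 1 ≤ k) :
    (fDistribution k k).map (fun x ↦ x⁻¹) = fDistribution k k := by
  have := isProbabilityMeasure_chiSquare hk
  rw [fDistribution_self hk, Measure.map_map (by fun_prop) (by fun_prop)]
  conv_rhs => rw [← Measure.prod_swap, Measure.map_map (by fun_prop) (by fun_prop)]
  congr 1
  ext z
  simp

lemma setLIntegral_Ioi_comp_mul_left {y : ℝ} (hy : 0 < y) {h : ℝ → ℝ≥0∞} (hh : Measurable h) :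
    ∫⁻ x in Set.Ioi 0, h x = ENNReal.ofReal y * ∫⁻ w in Set.Ioi 0, h (y * w) := by
  have hv := Real.smul_map_volume_mul_left hy.ne'
  rw [abs_of_pos hy] at hv
  rw [← lintegral_indicator measurableSet_Ioi, ← lintegral_indicator measurableSet_Ioi]
  conv_lhs => rw [← hv]
  rw [lintegral_smul_measure, smul_eq_mul,
    lintegral_map (hh.indicator measurableSet_Ioi) (by fun_prop)]
  congr 2
  ext w
  simp [Set.indicator, hy]

/-- The density of the law of the ratio of two independent Gamma variables of shape `a`, up to the
normalising constant. -/
noncomputable def betaPrimeKernel (a w : ℝ) : ℝ :=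
  w⁻¹ * (w / (1 + w) ^ 2) ^ a

lemma betaPrimeKernel_pos {a w : ℝ} (hw : 0 < w) : 0 < betaPrimeKernel a w := by
  unfold betaPrimeKernel
  positivity

@[fun_prop]
lemma measurable_betaPrimeKernel (a : ℝ) : Measurable (betaPrimeKernel a) := by
  unfold betaPrimeKernel
  fun_prop

@[fun_prop]
lemma measurable_gammaPDF (a r : ℝ) : Measurable (gammaPDF a r) := by
  unfold gammaPDF
  fun_prop

/-- As a function of `y`, the integrand is a multiple of the Gamma density of shape `2a` and rate
`(1 + w)/2`, whose integral is `1`. -/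
lemma setLIntegral_gammaPDF_mul {a w : ℝ} (ha : 0 < a) (hw : 0 < w) :
    ∫⁻ y in Set.Ioi 0, ENNReal.ofReal y *
        (gammaPDF a (1 / 2) (y * w) * gammaPDF a (1 / 2) y) =
      ENNReal.ofReal (Real.Gamma (2 * a) / Real.Gamma a ^ 2 * betaPrimeKernel a w) := by
  have hr : 0 < (1 + w) / 2 := by positivity
  have hΓ : 0 < Real.Gamma a := Real.Gamma_pos_of_pos ha
  have hΓ2 : 0 < Real.Gamma (2 * a) := Real.Gamma_pos_of_pos (by positivity)
  have hone : ∫⁻ y in Set.Ioi 0, gammaPDF (2 * a) ((1 + w) / 2) y = 1 := by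
    have h := lintegral_add_compl (μ := volume) (gammaPDF (2 * a) ((1 + w) / 2))
      (measurableSet_Ioi (a := (0 : ℝ)))
    rwa [Set.compl_Ioi, setLIntegral_congr (Iio_ae_eq_Iic (a := (0 : ℝ))).symm,
      lintegral_gammaPDF_of_nonpos le_rfl, add_zero,
      lintegral_gammaPDF_eq_one (by positivity : 0 < 2 * a) hr] at h
  rw [← mul_one (ENNReal.ofReal (_ * betaPrimeKernel a w)), ← hone,
    ← lintegral_const_mul _ (by fun_prop)]
  refine setLIntegral_congr_fun measurableSet_Ioi fun y hy ↦ ?_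
  have hy : 0 < y := hy
  have hyw : 0 < y * w := by positivity
  have hk := (betaPrimeKernel_pos (a := a) hw).le
  simp only [gammaPDF]
  rw [← ENNReal.ofReal_mul (gammaPDFReal_nonneg ha (by norm_num) _), ← ENNReal.ofReal_mul hy.le,
    ← ENNReal.ofReal_mul (by positivity)]
  congr 1
  simp only [gammaPDFReal, if_pos hy.le, if_pos hyw.le, betaPrimeKernel]
  have e1 : Real.exp (-(1 / 2 * (y * w))) * Real.exp (-(1 / 2 * y)) =
      Real.exp (-((1 + w) / 2 * y)) := by
    rw [← Real.exp_add]; congr 1; ring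
  have e2 : (y * w) ^ (a - 1) = y ^ (a - 1) * (w ^ a * w⁻¹) := by
    rw [Real.mul_rpow hy.le hw.le, Real.rpow_sub_one hw.ne' a, div_eq_mul_inv]
  have e3 : y ^ (2 * a - 1) = y * y ^ (a - 1) * y ^ (a - 1) := by
    rw [Real.rpow_sub_one hy.ne', Real.rpow_sub_one hy.ne', two_mul, Real.rpow_add hy]
    field_simp
  have e4 : ((1 + w) / 2) ^ (2 * a) = ((1 + w) ^ a * (1 / 2 : ℝ) ^ a) ^ 2 := by
    rw [two_mul, Real.rpow_add hr, ← sq, ← Real.mul_rpow (by positivity) (by norm_num)]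
    congr 3; ring
  have e5 : (w / (1 + w) ^ 2) ^ a = w ^ a / ((1 + w) ^ a) ^ 2 := by
    rw [Real.div_rpow hw.le (by positivity), ← Real.rpow_natCast, ← Real.rpow_natCast,
      ← Real.rpow_mul (by positivity), ← Real.rpow_mul (by positivity), mul_comm a]
  rw [e2, e3, e4, e5, ← e1]
  have : (0 : ℝ) < (1 + w) ^ a := by positivity
  field_simp

/-- Fix the denominator `y`, substitute `x = y w` in the numerator, and integrate out `y` by
Tonelli. -/
lemma fDistribution_self_eq_withDensity {k : ℕ} (hk : 1 ≤ k) :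
    ∃ C : ℝ, 0 < C ∧ fDistribution k k = (volume.restrict (Set.Ioi 0)).withDensity
      fun w ↦ ENNReal.ofReal (C * betaPrimeKernel (k / 2) w) := by
  have ha : (0 : ℝ) < k / 2 := by positivity
  have := isProbabilityMeasure_chiSquare hk
  refine ⟨Real.Gamma (2 * (k / 2)) / Real.Gamma (k / 2) ^ 2, by positivity, ?_⟩
  refine Measure.ext_of_lintegral _ fun f hf ↦ ?_
  rw [fDistribution_self hk, lintegral_map hf (by fun_prop), lintegral_prod_symm' _ (by fun_prop),
    lintegral_withDensity_eq_lintegral_mul _ (by fun_prop) hf]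
  simp only [chiSquare_eq_withDensity_restrict]
  rw [lintegral_withDensity_eq_lintegral_mul _ (by fun_prop)
    (Measurable.lintegral_prod_left (by fun_prop))]
  set g := gammaPDF ((k : ℝ) / 2) (1 / 2) with hg
  have hgm : Measurable g := measurable_gammaPDF _ _
  calc ∫⁻ y in Set.Ioi 0, g y * ∫⁻ x, f (x / y) ∂((volume.restrict (Set.Ioi 0)).withDensity g)
      = ∫⁻ y in Set.Ioi 0, ∫⁻ w in Set.Ioi 0,
          ENNReal.ofReal y * (g (y * w) * g y) * f w := by
        refine setLIntegral_congr_fun measurableSet_Ioi fun y hy ↦ ?_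
        have hy : 0 < y := hy
        rw [lintegral_withDensity_eq_lintegral_mul _ hgm (by fun_prop),
          setLIntegral_Ioi_comp_mul_left hy (by fun_prop), mul_left_comm,
          ← lintegral_const_mul _ (by simp only [Pi.mul_apply]; fun_prop),
          ← lintegral_const_mul _ (by simp only [Pi.mul_apply]; fun_prop)]
        refine lintegral_congr fun w ↦ ?_
        simp only [Pi.mul_apply, mul_div_cancel_left₀ w hy.ne']
        ring
    _ = ∫⁻ w in Set.Ioi 0, ∫⁻ y in Set.Ioi 0, ENNReal.ofReal y * (g (y * w) * g y) * f w :=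
        lintegral_lintegral_swap (by fun_prop)
    _ = _ := by
        refine setLIntegral_congr_fun measurableSet_Ioi fun w hw ↦ ?_
        simp only [Pi.mul_apply]
        rw [lintegral_mul_const _ (by fun_prop), setLIntegral_gammaPDF_mul ha hw]

lemma fDistribution_self_absolutelyContinuous {k : ℕ} (hk : 1 ≤ k) :
    fDistribution k k ≪ volume.restrict (Set.Ioi 0) := by
  obtain ⟨C, -, h⟩ := fDistribution_self_eq_withDensity hk
  rw [h]
  exact withDensity_absolutelyContinuous _ _

lemma nullSingletonClass_fDistribution_self {k : ℕ} (hk : 1 ≤ k) :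
    NullSingletonClass (fDistribution k k) :=
  ⟨fun x ↦ fDistribution_self_absolutelyContinuous hk (measure_singleton x)⟩

lemma fDistribution_self_Iic_zero {k : ℕ} (hk : 1 ≤ k) : fDistribution k k (Set.Iic 0) = 0 :=
  fDistribution_self_absolutelyContinuous hk (by
    rw [Measure.restrict_apply measurableSet_Iic, Set.Iic_inter_Ioi, Set.Ioc_self, measure_empty])

/-- Inversion exchanges `[1, ∞)` and `(0, 1]`, which carry all the mass and overlap in a null set.
-/
lemma fDistribution_self_Ici_one {k : ℕ} (hk : 1 ≤ k) :
    (fDistribution k k).real (Set.Ici 1) = 1 / 2 := by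
  have := isProbabilityMeasure_fDistribution hk hk
  have := nullSingletonClass_fDistribution_self hk
  have h0 := fDistribution_self_Iic_zero hk
  have h1 : fDistribution k k (Set.Ici 1) = fDistribution k k (Set.Iic 1) := by
    conv_lhs => rw [← map_inv_fDistribution_self hk]
    rw [Measure.map_apply (by fun_prop) measurableSet_Ici]
    have hpre : (fun x : ℝ ↦ x⁻¹) ⁻¹' Set.Ici 1 = Set.Ioc 0 1 := by
      ext x
      simp only [Set.mem_preimage, Set.mem_Ici, Set.mem_Ioc]
      exact one_le_inv_iff₀
    rw [hpre, ← Set.Iic_union_Ioc_eq_Iic (zero_le_one' ℝ)]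
    refine le_antisymm (measure_mono Set.subset_union_right) ((measure_union_le _ _).trans ?_)
    rw [h0, zero_add]
  have h2 : (fDistribution k k).real (Set.Ici 1) = (fDistribution k k).real (Set.Iic 1) :=
    congrArg ENNReal.toReal h1
  have h3 := probReal_compl_eq_one_sub (μ := fDistribution k k) (measurableSet_Iic (a := (1 : ℝ)))
  rw [Set.compl_Iic, ← h2, measureReal_congr Ioi_ae_eq_Ici] at h3
  linarith

/-! ### Comparison of the tails of `F(k, k)` and `F(l, l)`. -/

lemma antitoneOn_div_one_add_sq :
    AntitoneOn (fun w : ℝ ↦ w / (1 + w) ^ 2) (Set.Ici 1) := by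
  intro x hx y hy hxy
  have hx : 1 ≤ x := hx
  have hy : 1 ≤ y := hy
  simp only
  rw [div_le_div_iff₀ (by positivity) (by positivity)]
  -- After cross-multiplication the difference of the two sides is `(y - x)(xy - 1)`.
  nlinarith [mul_nonneg (sub_nonneg.2 hxy) (sub_nonneg.2 (one_le_mul_of_one_le_of_one_le hx hy))]

lemma mul_betaPrimeKernel_le_iff {a b A B w : ℝ} (hw : 0 < w) :
    B * betaPrimeKernel b w ≤ A * betaPrimeKernel a w ↔
      B * (w / (1 + w) ^ 2) ^ (b - a) ≤ A := by
  have ht : 0 < w / (1 + w) ^ 2 := by positivity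
  have h : betaPrimeKernel b w = (w / (1 + w) ^ 2) ^ (b - a) * betaPrimeKernel a w := by
    unfold betaPrimeKernel
    rw [mul_left_comm, ← Real.rpow_add ht, sub_add_cancel]
  rw [h, ← mul_assoc, mul_le_mul_iff_left₀ (betaPrimeKernel_pos hw)]

/-- Beyond the common median `1`, the upper tail of `F(k, k)` decreases with `k`. -/
lemma fDistribution_self_Ici_antitone {k l : ℕ} (hk : 1 ≤ k) (hkl : k ≤ l) {x : ℝ} (hx : 1 ≤ x) :
    (fDistribution l l).real (Set.Ici x) ≤ (fDistribution k k).real (Set.Ici x) := by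
  have hl : 1 ≤ l := hk.trans hkl
  have := isProbabilityMeasure_fDistribution hk hk
  have := isProbabilityMeasure_fDistribution hl hl
  obtain ⟨A, hA, hA'⟩ := fDistribution_self_eq_withDensity hk
  obtain ⟨B, hB, hB'⟩ := fDistribution_self_eq_withDensity hl
  have hanti : AntitoneOn (fun w : ℝ ↦ B * (w / (1 + w) ^ 2) ^ ((l : ℝ) / 2 - k / 2))
      (Set.Ici 1) := by
    intro u hu v hv huv
    have hu : 1 ≤ u := hu
    have hv : 1 ≤ v := hv
    have hkl' : (k : ℝ) ≤ l := by exact_mod_cast hkl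
    have := antitoneOn_div_one_add_sq hu hv huv
    simp only at this ⊢
    gcongr
    linarith
  have hpos : ∀ {w : ℝ}, 1 ≤ w → 0 < w := fun h ↦ by linarith
  -- The density ratio decreases on `[1, ∞)`. If it is at most `1` at `x`, the densities compare on
  -- all of `[x, ∞)`. Otherwise they compare the other way on `[1, x)`, and the total mass `1/2` of
  -- `[1, ∞)` transfers this to the tails.
  by_cases hcase : B * (x / (1 + x) ^ 2) ^ ((l : ℝ) / 2 - k / 2) ≤ A
  · refine ENNReal.toReal_mono (measure_ne_top _ _) ?_
    rw [hA', hB', withDensity_apply _ measurableSet_Ici, withDensity_apply _ measurableSet_Ici]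
    refine lintegral_mono_ae ((ae_restrict_mem measurableSet_Ici).mono fun w hw ↦ ?_)
    have hw : x ≤ w := hw
    exact ENNReal.ofReal_le_ofReal ((mul_betaPrimeKernel_le_iff (hpos (hx.trans hw))).2
      ((hanti hx (hx.trans hw) hw).trans hcase))
  · have hIco : (fDistribution k k).real (Set.Ico 1 x) ≤ (fDistribution l l).real (Set.Ico 1 x) := by
      refine ENNReal.toReal_mono (measure_ne_top _ _) ?_
      rw [hA', hB', withDensity_apply _ measurableSet_Ico, withDensity_apply _ measurableSet_Ico]
      refine lintegral_mono_ae ((ae_restrict_mem measurableSet_Ico).mono fun w hw ↦ ?_)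
      refine ENNReal.ofReal_le_ofReal (le_of_not_ge fun hle ↦ hcase ?_)
      exact (hanti hw.1 hx hw.2.le).trans ((mul_betaPrimeKernel_le_iff (hpos hw.1)).1 hle)
    have hsplit : ∀ m : ℕ, 1 ≤ m →
        (fDistribution m m).real (Set.Ico 1 x) + (fDistribution m m).real (Set.Ici x) = 1 / 2 := by
      intro m hm
      have hdisj : Disjoint (Set.Ico 1 x) (Set.Ici x) :=
        Set.disjoint_left.2 fun w hw hw' ↦ not_le.2 hw.2 hw'
      have := isProbabilityMeasure_fDistribution hm hm
      rw [← fDistribution_self_Ici_one hm, ← Set.Ico_union_Ici_eq_Ici hx,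
        measureReal_union hdisj measurableSet_Ici]
    linarith [hsplit k hk, hsplit l hl]

/-! ### Upper quantiles of atomless laws. -/

section UpperQuantile

open Filter Topology

variable {μ : Measure ℝ} [IsProbabilityMeasure μ]

lemma continuous_cdf [NullSingletonClass μ] : Continuous (cdf μ) := by
  refine continuous_iff_continuousAt.2 fun x ↦ ?_
  rw [(monotone_cdf μ).continuousAt_iff_leftLim_eq_rightLim, StieltjesFunction.rightLim_eq]
  have h := (cdf μ).measure_singleton x
  rw [measure_cdf, measure_singleton, eq_comm, ENNReal.ofReal_eq_zero] at h
  exact le_antisymm ((monotone_cdf μ).leftLim_le le_rfl) (by linarith)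

lemma measureReal_Ioi_eq_one_sub_cdf (x : ℝ) : μ.real (Set.Ioi x) = 1 - cdf μ x := by
  rw [← Set.compl_Iic, probReal_compl_eq_one_sub measurableSet_Iic, cdf_eq_real]

lemma nonempty_setOf_measureReal_Ioi_le {α : ℝ} (hα : 0 < α) :
    {x : ℝ | μ.real (Set.Ioi x) ≤ α}.Nonempty := by
  obtain ⟨x, hx⟩ := ((tendsto_cdf_atTop μ).eventually_const_le
    (by linarith : 1 - α < 1)).exists
  refine ⟨x, ?_⟩
  simp only [Set.mem_ofPred_eq, measureReal_Ioi_eq_one_sub_cdf]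
  linarith

/-- The distribution function is continuous: the infimum is attained, and it lies below a point
where the value `1 - α` is taken exactly. -/
lemma measureReal_Ici_upperQuantile [NullSingletonClass μ] {α : ℝ} (hα0 : 0 < α) (hα1 : α < 1) :
    μ.real (Set.Ici (upperQuantile μ α)) = α := by
  have hset : {x : ℝ | μ.real (Set.Ioi x) ≤ α} = {x | 1 - α ≤ cdf μ x} := by
    ext x
    simp only [Set.mem_ofPred_eq, measureReal_Ioi_eq_one_sub_cdf]
    constructor <;> intro h <;> linarith
  have hclosed : IsClosed {x | 1 - α ≤ cdf μ x} := isClosed_le continuous_const continuous_cdf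
  obtain ⟨b, hb⟩ := ((tendsto_cdf_atBot μ).eventually_lt_const
    (by linarith : 0 < 1 - α)).exists
  obtain ⟨t, ht⟩ := ((tendsto_cdf_atTop μ).eventually_const_le
    (by linarith : 1 - α < 1)).exists
  have hbdd : BddBelow {x | 1 - α ≤ cdf μ x} := by
    refine ⟨b, fun x hx ↦ le_of_not_gt fun hlt ↦ ?_⟩
    have hx : 1 - α ≤ cdf μ x := hx
    linarith [monotone_cdf μ hlt.le]
  obtain ⟨y, hy⟩ := mem_range_of_exists_le_of_exists_ge continuous_cdf ⟨b, hb.le⟩ ⟨t, ht⟩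
  have hmem : 1 - α ≤ cdf μ (sInf {x | 1 - α ≤ cdf μ x}) := hclosed.csInf_mem ⟨t, ht⟩ hbdd
  have hle := monotone_cdf μ (csInf_le hbdd (show y ∈ {x | 1 - α ≤ cdf μ x} from hy.ge))
  rw [upperQuantile, hset, ← measureReal_congr Ioi_ae_eq_Ici, measureReal_Ioi_eq_one_sub_cdf]
  linarith

end UpperQuantile

/-- Half of the mass lies in `[1, ∞)`, so a point `b < 1` with tail at most `1/2` would make `(max b
0, 1)` null, although the density is positive there. -/
lemma one_le_upperQuantile_fDistribution_self {k : ℕ} (hk : 1 ≤ k) {α : ℝ} (hα0 : 0 < α)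
    (hα : α ≤ 1 / 2) : 1 ≤ upperQuantile (fDistribution k k) α := by
  have := isProbabilityMeasure_fDistribution hk hk
  refine le_csInf (nonempty_setOf_measureReal_Ioi_le hα0) fun b hb ↦ le_of_not_gt fun hlt ↦ ?_
  have hb : (fDistribution k k).real (Set.Ioi b) ≤ α := hb
  obtain ⟨C, hC, hC'⟩ := fDistribution_self_eq_withDensity hk
  have hzero : (fDistribution k k).real (Set.Ioo (max b 0) 1) ≤ 0 := by
    have hsub : Set.Ioo (max b 0) 1 ∪ Set.Ici 1 ⊆ Set.Ioi b := by
      rintro w (hw | hw)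
      · exact (le_max_left b 0).trans_lt hw.1
      · exact hlt.trans_le hw
    have hdisj : Disjoint (Set.Ioo (max b 0) 1) (Set.Ici 1) :=
      Set.disjoint_left.2 fun w hw hw' ↦ not_le.2 hw.2 hw'
    have h := measureReal_mono (μ := fDistribution k k) hsub
    rw [measureReal_union hdisj measurableSet_Ici,
      fDistribution_self_Ici_one hk] at h
    linarith
  have hzero' : fDistribution k k (Set.Ioo (max b 0) 1) = 0 :=
    (measureReal_eq_zero_iff).1 (le_antisymm hzero measureReal_nonneg)
  rw [hC', withDensity_apply_eq_zero (by fun_prop)] at hzero'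
  have hinter : {w | ENNReal.ofReal (C * betaPrimeKernel (k / 2) w) ≠ 0} ∩ Set.Ioo (max b 0) 1 =
      Set.Ioo (max b 0) 1 := by
    refine Set.inter_eq_right.2 fun w hw ↦ ?_
    have hw0 : 0 < w := (le_max_right b 0).trans_lt hw.1
    have := betaPrimeKernel_pos (a := (k : ℝ) / 2) hw0
    simp only [Set.mem_ofPred_eq, ne_eq, ENNReal.ofReal_eq_zero, not_le]
    positivity
  have hpos : Set.Ioo (max b 0) 1 ⊆ Set.Ioi 0 := fun w hw ↦ (le_max_right b 0).trans_lt hw.1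
  rw [hinter, Measure.restrict_apply measurableSet_Ioo, Set.inter_eq_left.2 hpos, Real.volume_Ioo,
    ENNReal.ofReal_eq_zero] at hzero'
  linarith [max_lt hlt (zero_lt_one' ℝ)]

/-! ### Independence of the two spreads and the test. -/

lemma sampleSpread_nonneg {D n : ℕ} (p : Fin n → EuclideanSpace ℝ (Fin D)) :
    0 ≤ sampleSpread p := by
  unfold sampleSpread
  positivity

lemma indepFun_sampleSpread {Ω : Type*} [MeasurableSpace Ω] {P : Measure Ω} {D n : ℕ}
    {p₁ p₂ : Fin n → Ω → EuclideanSpace ℝ (Fin D)} (hp₁ : ∀ i, AEMeasurable (p₁ i) P)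
    (hp₂ : ∀ i, AEMeasurable (p₂ i) P) (hindep : iIndepFun (Sum.elim p₁ p₂) P) :
    IndepFun (fun ω ↦ sampleSpread fun i ↦ p₁ i ω) (fun ω ↦ sampleSpread fun i ↦ p₂ i ω) P := by
  let S : Finset (Fin n ⊕ Fin n) := Finset.univ.map Function.Embedding.inl
  let T : Finset (Fin n ⊕ Fin n) := Finset.univ.map Function.Embedding.inr
  have h := hindep.indepFun_finset₀ S T (Finset.disjoint_left.2 (by simp [S, T]))
    (by rintro (i | i) <;> simp [hp₁, hp₂])
  have hS : ∀ i, Sum.inl i ∈ S := by simp [S]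
  have hT : ∀ i, Sum.inr i ∈ T := by simp [T]
  have hφ : Measurable fun (x : S → EuclideanSpace ℝ (Fin D)) ↦
      sampleSpread fun i ↦ x ⟨Sum.inl i, hS i⟩ :=
    measurable_sampleSpread.comp (measurable_pi_lambda _ fun i ↦ measurable_pi_apply _)
  have hψ : Measurable fun (x : T → EuclideanSpace ℝ (Fin D)) ↦
      sampleSpread fun i ↦ x ⟨Sum.inr i, hT i⟩ :=
    measurable_sampleSpread.comp (measurable_pi_lambda _ fun i ↦ measurable_pi_apply _)
  exact h.comp hφ hψ

end EnsembleOptima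

open EnsembleOptima in
theorem theorem3 {Ω : Type*} [MeasurableSpace Ω] (P : Measure Ω) [IsProbabilityMeasure P]
    (D n : ℕ) (hD : 1 ≤ D) (hn : 2 ≤ n)
    (c₁ c₂ : EuclideanSpace ℝ (Fin D)) (σ₁ σ₂ : ℝ) (hσ₁ : 0 < σ₁) (hσ₂ : 0 < σ₂)
    (p₁ p₂ : Fin n → Ω → EuclideanSpace ℝ (Fin D))
    (hp₁ : ∀ i, HasLaw (p₁ i) (EnsembleOptima.optimumLaw c₁ σ₁) P)
    (hp₂ : ∀ i, HasLaw (p₂ i) (EnsembleOptima.optimumLaw c₂ σ₂) P)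
    (hindep : iIndepFun (Sum.elim p₁ p₂) P) :
    -- The expected squared distances exist, and comparing them is comparing the deviations.
    (Integrable (fun p => ‖c₁ - p‖ ^ 2) (EnsembleOptima.optimumLaw c₁ σ₁) ∧
      Integrable (fun p => ‖c₂ - p‖ ^ 2) (EnsembleOptima.optimumLaw c₂ σ₂) ∧
      (EnsembleOptima.expectedSqDist c₂ σ₂ ≤ EnsembleOptima.expectedSqDist c₁ σ₁ ↔ σ₂ ≤ σ₁)) ∧
    -- The laws of the scaled sample spreads and of their scaled ratio.
    (HasLaw (fun ω => n * EnsembleOptima.sampleSpread (fun i => p₁ i ω) / σ₁ ^ 2)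
        (EnsembleOptima.chiSquare (D * (n - 1))) P ∧
      HasLaw (fun ω => n * EnsembleOptima.sampleSpread (fun i => p₂ i ω) / σ₂ ^ 2)
        (EnsembleOptima.chiSquare (D * (n - 1))) P ∧
      HasLaw (fun ω => (EnsembleOptima.sampleSpread (fun i => p₁ i ω) * σ₂ ^ 2) /
          (EnsembleOptima.sampleSpread (fun i => p₂ i ω) * σ₁ ^ 2))
        (EnsembleOptima.fDistribution (D * (n - 1)) (D * (n - 1))) P) ∧
    -- Type one error at most `α` with the threshold `F_α(n-1, n-1)`.
    (∀ α : ℝ, 0 < α → α ≤ 1 / 2 →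
      EnsembleOptima.expectedSqDist c₁ σ₁ ≤ EnsembleOptima.expectedSqDist c₂ σ₂ →
      P.real {ω | EnsembleOptima.upperQuantile
            (EnsembleOptima.fDistribution (n - 1) (n - 1)) α ≤
          EnsembleOptima.sampleSpread (fun i => p₁ i ω) /
            EnsembleOptima.sampleSpread (fun i => p₂ i ω)} ≤ α) ∧
    -- Type one error exactly `α` with the threshold `F_α(D(n-1), D(n-1))`, which is
    -- `F_α(n-1, n-1)` when `D = 1`: at most `α` under the null hypothesis, `α` on its boundary.
    (∀ α : ℝ, 0 < α → α < 1 →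
      (EnsembleOptima.expectedSqDist c₁ σ₁ ≤ EnsembleOptima.expectedSqDist c₂ σ₂ →
        P.real {ω | EnsembleOptima.upperQuantile
              (EnsembleOptima.fDistribution (D * (n - 1)) (D * (n - 1))) α ≤
            EnsembleOptima.sampleSpread (fun i => p₁ i ω) /
              EnsembleOptima.sampleSpread (fun i => p₂ i ω)} ≤ α) ∧
      (EnsembleOptima.expectedSqDist c₁ σ₁ = EnsembleOptima.expectedSqDist c₂ σ₂ →
        P.real {ω | EnsembleOptima.upperQuantile
              (EnsembleOptima.fDistribution (D * (n - 1)) (D * (n - 1))) α ≤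
            EnsembleOptima.sampleSpread (fun i => p₁ i ω) /
              EnsembleOptima.sampleSpread (fun i => p₂ i ω)} = α)) := by
  have hk : 1 ≤ n - 1 := by omega
  have hDk : 1 ≤ D * (n - 1) := Nat.mul_pos hD hk
  obtain ⟨K, hK, hE⟩ := exists_expectedSqDist_eq hD
  rw [hE c₁ σ₁ hσ₁, hE c₂ σ₂ hσ₂]
  have hsq : K * σ₂ ^ 2 ≤ K * σ₁ ^ 2 ↔ σ₂ ≤ σ₁ := by
    rw [mul_le_mul_iff_right₀ hK, sq_le_sq₀ hσ₂.le hσ₁.le]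
  have hn0 : (n : ℝ) ≠ 0 := by positivity
  have hindep₁ : iIndepFun p₁ P := hindep.precomp (g := Sum.inl) Sum.inl_injective
  have hindep₂ : iIndepFun p₂ P := hindep.precomp (g := Sum.inr) Sum.inr_injective
  have hlaw₁ := hasLaw_sampleSpread hD hn hσ₁ hp₁ hindep₁
  have hlaw₂ := hasLaw_sampleSpread hD hn hσ₂ hp₂ hindep₂
  have hratio : HasLaw (fun ω ↦ (sampleSpread (fun i ↦ p₁ i ω) * σ₂ ^ 2) /
      (sampleSpread (fun i ↦ p₂ i ω) * σ₁ ^ 2))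
      (fDistribution (D * (n - 1)) (D * (n - 1))) P := by
    have := isProbabilityMeasure_chiSquare hDk
    have hind := (indepFun_sampleSpread (fun i ↦ (hp₁ i).aemeasurable)
      (fun i ↦ (hp₂ i).aemeasurable) hindep).comp
        (φ := fun x ↦ n * x / σ₁ ^ 2) (ψ := fun x ↦ n * x / σ₂ ^ 2) (by fun_prop) (by fun_prop)
    have hprod := (indepFun_iff_hasLaw_prodMk_prod hlaw₁ hlaw₂).1 hind
    rw [fDistribution_self hDk]
    have hdiv : HasLaw (fun z : ℝ × ℝ ↦ z.1 / z.2)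
        (((chiSquare (D * (n - 1))).prod (chiSquare (D * (n - 1)))).map fun z ↦ z.1 / z.2)
        ((chiSquare (D * (n - 1))).prod (chiSquare (D * (n - 1)))) := ⟨by fun_prop, rfl⟩
    refine (hdiv.fun_comp hprod).congr (.of_forall fun ω ↦ ?_)
    simp only
    field_simp
  -- This also holds where the second spread vanishes, both sides then being `0`.
  have hrw : ∀ ω, (sampleSpread (fun i ↦ p₁ i ω) * σ₂ ^ 2) /
      (sampleSpread (fun i ↦ p₂ i ω) * σ₁ ^ 2) =
      sampleSpread (fun i ↦ p₁ i ω) / sampleSpread (fun i ↦ p₂ i ω) * (σ₂ ^ 2 / σ₁ ^ 2) :=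
    fun ω ↦ mul_div_mul_comm _ _ _ _
  have htail : ∀ q : ℝ, P.real {ω | q ≤ (sampleSpread (fun i ↦ p₁ i ω) * σ₂ ^ 2) /
      (sampleSpread (fun i ↦ p₂ i ω) * σ₁ ^ 2)} =
      (fDistribution (D * (n - 1)) (D * (n - 1))).real (Set.Ici q) :=
    fun q ↦ hratio.measureReal_eq (p := fun x ↦ q ≤ x) measurableSet_Ici
  -- Under the null hypothesis `σ₂²/σ₁² ≥ 1`, so rescaling can only enlarge the nonnegative ratio.
  have hnull : K * σ₁ ^ 2 ≤ K * σ₂ ^ 2 → ∀ q : ℝ,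
      P.real {ω | q ≤ sampleSpread (fun i ↦ p₁ i ω) / sampleSpread (fun i ↦ p₂ i ω)} ≤
        (fDistribution (D * (n - 1)) (D * (n - 1))).real (Set.Ici q) := by
    intro h q
    rw [← htail q]
    refine measureReal_mono fun ω hω ↦ ?_
    have hω : q ≤ sampleSpread (fun i ↦ p₁ i ω) / sampleSpread (fun i ↦ p₂ i ω) := hω
    change q ≤ _
    rw [hrw ω]
    refine hω.trans (le_mul_of_one_le_right
      (div_nonneg (sampleSpread_nonneg _) (sampleSpread_nonneg _)) ?_)
    rw [one_le_div₀ (by positivity)]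
    exact le_of_mul_le_mul_left h hK
  have := isProbabilityMeasure_fDistribution hk hk
  have := isProbabilityMeasure_fDistribution hDk hDk
  have := nullSingletonClass_fDistribution_self hk
  have := nullSingletonClass_fDistribution_self hDk
  refine ⟨⟨integrable_norm_sq_optimumLaw c₁ σ₁, integrable_norm_sq_optimumLaw c₂ σ₂, hsq⟩,
    ⟨hlaw₁, hlaw₂, hratio⟩, fun α hα0 hα h ↦ ?_, fun α hα0 hα1 ↦ ⟨fun h ↦ ?_, fun h ↦ ?_⟩⟩
  · refine (hnull h _).trans ((fDistribution_self_Ici_antitone hk (Nat.le_mul_of_pos_left _ hD)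
      (one_le_upperQuantile_fDistribution_self hk hα0 hα)).trans_eq ?_)
    exact measureReal_Ici_upperQuantile hα0 (by linarith)
  · exact (hnull h _).trans_eq (measureReal_Ici_upperQuantile hα0 hα1)
  · have hone : σ₂ ^ 2 / σ₁ ^ 2 = 1 := by
      rw [mul_left_cancel₀ hK.ne' h, div_self (by positivity)]
    have htail' := htail (upperQuantile (fDistribution (D * (n - 1)) (D * (n - 1))) α)
    simp only [hrw, hone, mul_one] at htail'
    rw [htail', measureReal_Ici_upperQuantile hα0 hα1]
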